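/- Let $\mathbb{P}_r$ and $\mathbb{P}_\theta$ be probability distributions on a measurable space $\mathcal{X}$, let $\mathcal{H}$ be a nonempty set of functions $h\colon\mathcal{X}\to\mathcal{Y}$ and let $\ell\colon\mathcal{Y}\times\mathcal{Y}\to\mathbb{R}$ be a loss function. Let $\ell_{\mathcal{H}}=\{x\mapsto \ell(h(x),h'(x)) : h,h'\in\mathcal{H}\}$, and define the discrepancy of two distributions by $$\mathrm{disc}(\mathbb{P},\mathbb{Q})=\sup_{h,h'\in\mathcal{H}}\Big|\mathbb{E}_{x\sim\mathbb{P}}[\ell(h(x),h'(x))]-\mathbb{E}_{x\sim\mathbb{Q}}[\ell(h(x),h'(x))]\Big| .$$ For a sample $S=(x_1,\dots,x_m)$ and a class $\mathcal{G}$ of real functions on $\mathcal{X}$, let $$\widehat{\mathfrak{R}}_S(\mathcal{G})=\frac{2}{m}\,\mathbb{E}_\sigma\Big[\sup_{g\in\mathcal{G}}\sum_{i=1}^m\sigma_i g(x_i)\Big]\in(-\infty,+\infty]\qquad(\mathcal{G}\neq\emptyset)$$ be its empirical Rademacher complexity, where $\sigma_1,\dots,\sigma_m$ are independent and uniform on $\{-1,1\}$.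 Assume that the functions in $\ell_{\mathcal{H}}$ are measurable, that for every $k$ and all signs $\sigma_1,\dots,\sigma_k\in\{-1,1\}$ the map $(x_1,\dots,x_k)\mapsto\sup_{g\in\ell_{\mathcal{H}}}\sum_{i=1}^k\sigma_i g(x_i)$ is measurable on $\mathcal{X}^k$ (as is always the case when $\ell_{\mathcal{H}}$ is countable), and that the loss is bounded along $\mathcal{H}$: $0\le\ell(h(x),h'(x))\le M$ for all $h,h'\in\mathcal{H}$ and $x\in\mathcal{X}$. Let $m,n\ge 1$, let $S_r$ and $S_\theta$ be independent i.i.d. samples of sizes $m$ and $n$ from $\mathbb{P}_r$ and $\mathbb{P}_\theta$, and let $\widehat{\mathbb{P}}_r$ and $\widehat{\mathbb{P}}_\theta$ be their empirical distributions. Then for every $\delta>0$, with probability at least $1-\delta$ over the draw of $S_r$ and $S_\theta$, $$\big|\mathrm{disc}(\mathbb{P}_r,\mathbb{P}_\theta)-\mathrm{disc}(\widehat{\mathbb{P}}_r,\widehat{\mathbb{P}}_\theta)\big|\le\widehat{\mathfrak{R}}_{S_r}(\ell_{\mathcal{H}})+\widehat{\mathfrak{R}}_{S_\theta}(\ell_{\mathcal{H}})+3M\Big(\sqrt{\tfrac{\log(4/\delta)}{2m}}+\sqrt{\tfrac{\log(4/\delta)}{2n}}\Big)$$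 (for $\delta\ge 1$ the claim is void). Furthermore, if $\mathcal{Y}=\mathbb{R}$ and the loss is a $q$-Lipschitz function of $h-h'$, that is, $\ell(h(x),h'(x))=f(h(x)-h'(x))$ for all $h,h'\in\mathcal{H}$ and $x\in\mathcal{X}$, with a $q$-Lipschitz function $f\colon\mathbb{R}\to\mathbb{R}$, then with probability at least $1-\delta$ the inequality above holds together with $$\big|\mathrm{disc}(\mathbb{P}_r,\mathbb{P}_\theta)-\mathrm{disc}(\widehat{\mathbb{P}}_r,\widehat{\mathbb{P}}_\theta)\big|\le 4q\Big(\widehat{\mathfrak{R}}_{S_r}(\mathcal{H})+\widehat{\mathfrak{R}}_{S_\theta}(\mathcal{H})\Big)+3M\Big(\sqrt{\tfrac{\log(4/\delta)}{2m}}+\sqrt{\tfrac{\log(4/\delta)}{2n}}\Big),$$ with the convention $0\cdot\infty=0$. -/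

import Mathlib

open MeasureTheory
open scoped NNReal ENNReal

/-- The discrepancy of two measures `P` and `Q` with respect to a hypothesis set `H` and a loss `ℓ`:
`sup_{h, h' ∈ H} |E_{x ∼ P} ℓ(h(x), h'(x)) - E_{x ∼ Q} ℓ(h(x), h'(x))|`.
The supremum is the intended one (and not a junk value) as soon as `H` is nonempty and the loss is
bounded and measurable along `H`. -/
noncomputable def disc {X Y : Type*} [MeasurableSpace X] (H : Set (X → Y)) (ℓ : Y → Y → ℝ)
    (P Q : Measure X) : ℝ :=
  sSup {r : ℝ | ∃ h ∈ H, ∃ h' ∈ H,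
    r = |(∫ x, ℓ (h x) (h' x) ∂P) - (∫ x, ℓ (h x) (h' x) ∂Q)|}

/-- The family `ℓ_H = {x ↦ ℓ(h(x), h'(x)) : h, h' ∈ H}` induced by the loss and the hypotheses. -/
def lossClass {X Y : Type*} (H : Set (X → Y)) (ℓ : Y → Y → ℝ) : Set (X → ℝ) :=
  {g | ∃ h ∈ H, ∃ h' ∈ H, g = fun x => ℓ (h x) (h' x)}

/-- The empirical distribution `(1/m) ∑ᵢ δ_{S i}` of a sample `S` of size `m`. -/
noncomputable def empiricalDist {X : Type*} [MeasurableSpace X] {m : ℕ} (S : Fin m → X) :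
    Measure X :=
  (m : ℝ≥0∞)⁻¹ • ∑ i, Measure.dirac (S i)

/-- `sup_{g ∈ G} ∑ᵢ σᵢ g(xᵢ)` for a vector `σ` of signs and points `x`, as an extended real. -/
noncomputable def signedSup {X : Type*} (G : Set (X → ℝ)) {k : ℕ} (σ : Fin k → ℤˣ)
    (x : Fin k → X) : EReal :=
  ⨆ g ∈ G, ((∑ i, ((σ i : ℤ) : ℝ) * g (x i) : ℝ) : EReal)

/-- The empirical Rademacher complexity `(2/m) E_σ [sup_{g ∈ G} ∑ᵢ σᵢ g(S i)]`, where the `σᵢ` are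
independent uniform signs, so that `E_σ` is the average over the `2 ^ m` sign vectors.
It takes the value `⊤` when the supremum is infinite for some `σ`. -/
noncomputable def empRademacher {X : Type*} (G : Set (X → ℝ)) {m : ℕ} (S : Fin m → X) : EReal :=
  ((2 / (m : ℝ) : ℝ) : EReal) * ((((2 : ℝ) ^ m)⁻¹ : ℝ) * ∑ σ : Fin m → ℤˣ, signedSup G σ S)

/-- The usual measurability convention for a class of functions: its members are measurable, and so
are the suprema over the class of signed sums along a sample, as functions of the sample. (It holds
for example for every countable class of measurable functions.) -/
def IsMeasurableClass {X : Type*} [MeasurableSpace X] (G : Set (X → ℝ)) : Prop :=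
  (∀ g ∈ G, Measurable g) ∧
    ∀ (k : ℕ) (σ : Fin k → ℤˣ), Measurable (fun x : Fin k → X => signedSup G σ x)

/-- The law of a pair of independent samples: `m` i.i.d. draws from `P` and `n` i.i.d. draws
from `Q`. -/
noncomputable def sampleLaw {X : Type*} [MeasurableSpace X] (P Q : Measure X) (m n : ℕ) :
    Measure ((Fin m → X) × (Fin n → X)) :=
  (Measure.pi fun _ : Fin m => P).prod (Measure.pi fun _ : Fin n => Q)

/-- The deviation term `3M (√(log(4/δ) / (2m)) + √(log(4/δ) / (2n)))`. -/
noncomputable def deviation (M δ : ℝ) (m n : ℕ) : ℝ :=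
  3 * M * (Real.sqrt (Real.log (4 / δ) / (2 * m)) + Real.sqrt (Real.log (4 / δ) / (2 * n)))

/-!
The discrepancy is stable: `|disc(P, Q) - disc(P̂, Q̂)|` is at most the sum of the uniform deviations
`sup_g |E_P g - E_P̂ g|` and `sup_g |E_Q g - E_Q̂ g|` over the loss class (`abs_disc_sub_disc_le`).
For each of the two samples and each sign `s`, the deviation `s (E g - Ê g)` is bounded for all `g`
at once, outside an event of probability `δ / 4`; these four events make up the total `δ`.

Four events suffice because McDiarmid's inequality is applied, in `exists_event_deviation_le`, to
the deviation minus the empirical Rademacher complexity. Changing one of `m` sample points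
changes the first by at most `M / m` and the second by at most `2M / m`, so the difference has
bounded differences `3M / m`, and its mean is nonpositive by symmetrization. McDiarmid's inequality
is obtained as a sub-Gaussian bound (`hasSubgaussianMGF_of_bounded_differences`), by induction on
the number of coordinates from Hoeffding's lemma.

The measurability convention for the class does not say that the supremum of `s (E g - Ê g)` is
measurable. It is replaced throughout by the larger `ghostDeviation`, in which `E g` becomes the
mean over an independent second sample, taken outside the supremum. This is a partial integral of a
signed supremum over `2m` points, hence measurable. Its expectation is bounded by that of the
empirical Rademacher complexity (`integral_pairSup_le`), because the joint law of the two samples is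
invariant under exchanging their `i`-th draws.

For a loss `f(h - h')` with `f` Lipschitz, the contraction principle (`sum_contraction_le`) bounds
the Rademacher complexity of the loss class by that of the differences `h - h'`, which is at most
twice that of `H` by the symmetry of the signs (`empRademacher_lossClass_le`). The second bound
therefore holds on the same event as the first.
-/

/-! ### The bounded differences inequality -/

open ProbabilityTheory in
/-- Sub-Gaussian bounds tensorize: if `F (a, ·)` is sub-Gaussian around its mean for every `a`, and
these means are sub-Gaussian around the mean of `F`, then so is `F`, with the constants added. -/
lemma hasSubgaussianMGF_prod {A B : Type*} [MeasurableSpace A] [MeasurableSpace B]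
    (μ : Measure A) (ν : Measure B) [IsProbabilityMeasure μ] [IsProbabilityMeasure ν]
    {F : A × B → ℝ} (hF : Measurable F) {K : ℝ} (hK : ∀ p, |F p| ≤ K) {c₁ c₂ : ℝ≥0}
    (h₁ : ∀ a, HasSubgaussianMGF (fun b => F (a, b) - ∫ b', F (a, b') ∂ν) c₁ ν)
    (h₂ : HasSubgaussianMGF (fun a => ∫ b, F (a, b) ∂ν - ∫ p, F p ∂(μ.prod ν)) c₂ μ) :
    HasSubgaussianMGF (fun p => F p - ∫ p', F p' ∂(μ.prod ν)) (c₁ + c₂) (μ.prod ν) := by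
  have hint : ∀ t : ℝ, Integrable (fun p => Real.exp (t * (F p - ∫ p', F p' ∂(μ.prod ν))))
      (μ.prod ν) := by
    intro t
    refine Integrable.of_bound (C := Real.exp (|t| * (K + |∫ p', F p' ∂(μ.prod ν)|)))
      (by fun_prop) (Filter.Eventually.of_forall fun p => ?_)
    rw [Real.norm_eq_abs, Real.abs_exp, Real.exp_le_exp]
    calc t * (F p - ∫ p', F p' ∂(μ.prod ν)) ≤ |t * (F p - ∫ p', F p' ∂(μ.prod ν))| := le_abs_self _
      _ = |t| * |F p - ∫ p', F p' ∂(μ.prod ν)| := abs_mul _ _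
      _ ≤ |t| * (|F p| + |∫ p', F p' ∂(μ.prod ν)|) := by gcongr; exact abs_sub _ _
      _ ≤ _ := by gcongr; exact hK p
  refine ⟨hint, fun t => ?_⟩
  have hsplit : ∀ a b, Real.exp (t * (F (a, b) - ∫ p', F p' ∂(μ.prod ν))) =
      Real.exp (t * (∫ b', F (a, b') ∂ν - ∫ p', F p' ∂(μ.prod ν))) *
        Real.exp (t * (F (a, b) - ∫ b', F (a, b') ∂ν)) := by
    intro a b
    rw [← Real.exp_add]
    ring_nf
  calc mgf (fun p => F p - ∫ p', F p' ∂(μ.prod ν)) (μ.prod ν) t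
      = ∫ a, Real.exp (t * (∫ b', F (a, b') ∂ν - ∫ p', F p' ∂(μ.prod ν))) *
          mgf (fun b => F (a, b) - ∫ b', F (a, b') ∂ν) ν t ∂μ := by
        rw [mgf, integral_prod _ (hint t)]
        refine integral_congr_ae (Filter.Eventually.of_forall fun a => ?_)
        simp only [hsplit, mgf, integral_const_mul]
    _ ≤ ∫ a, Real.exp (t * (∫ b', F (a, b') ∂ν - ∫ p', F p' ∂(μ.prod ν))) *
          Real.exp (c₁ * t ^ 2 / 2) ∂μ := by
        refine integral_mono_of_nonneg (Filter.Eventually.of_forall fun a => ?_)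
          ((h₂.integrable_exp_mul t).mul_const _) (Filter.Eventually.of_forall fun a => ?_)
        · exact mul_nonneg (Real.exp_pos _).le mgf_nonneg
        · exact mul_le_mul_of_nonneg_left ((h₁ a).mgf_le t) (Real.exp_pos _).le
    _ = mgf (fun a => ∫ b', F (a, b') ∂ν - ∫ p', F p' ∂(μ.prod ν)) μ t *
          Real.exp (c₁ * t ^ 2 / 2) := by
        rw [integral_mul_const, mgf]
    _ ≤ Real.exp (c₂ * t ^ 2 / 2) * Real.exp (c₁ * t ^ 2 / 2) := by
        gcongr
        exact h₂.mgf_le t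
    _ = Real.exp (((c₁ + c₂ : ℝ≥0) : ℝ) * t ^ 2 / 2) := by
        rw [← Real.exp_add]
        push_cast
        ring_nf

/-- A function with values in an interval of length `c` (given here by its oscillation) is
sub-Gaussian around its mean: Hoeffding's lemma. -/
lemma hasSubgaussianMGF_of_oscillation {A : Type*} [MeasurableSpace A] (μ : Measure A)
    [IsProbabilityMeasure μ] {g : A → ℝ} (hg : Measurable g) {c : ℝ≥0}
    (hc : ∀ a a', g a ≤ g a' + c) :
    ProbabilityTheory.HasSubgaussianMGF (fun a => g a - ∫ a', g a' ∂μ) ((c / 2) ^ 2) μ := by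
  have : Nonempty A := nonempty_of_isProbabilityMeasure μ
  obtain ⟨a₀⟩ := this
  have hbdd : BddBelow (Set.range g) := by
    refine ⟨g a₀ - c, ?_⟩
    rintro _ ⟨a, rfl⟩
    linarith [hc a₀ a]
  have h := ProbabilityTheory.hasSubgaussianMGF_of_mem_Icc (μ := μ) (X := g) (a := ⨅ a, g a)
    (b := (⨅ a, g a) + c) hg.aemeasurable (Filter.Eventually.of_forall fun a =>
      ⟨ciInf_le hbdd a, by
        have : Nonempty A := ⟨a⟩
        have := le_ciInf (f := g) (c := g a - c) fun a' => by linarith [hc a a']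
        linarith⟩)
  simpa using h

/-- A function on `Fin n → X` whose value increases by at most `c` under the change of one
coordinate has oscillation at most `n * c`. -/
lemma oscillation_le_of_bounded_differences {X : Type*} {c : ℝ} :
    ∀ {n : ℕ} {F : (Fin n → X) → ℝ},
      (∀ i x y, (∀ j, j ≠ i → x j = y j) → F x ≤ F y + c) → ∀ x y, F x ≤ F y + n * c
  | 0, F, _, x, y => by simp [Subsingleton.elim x y]
  | n + 1, F, h, x, y => by
    have h1 : F x ≤ F (Fin.cons (y 0) (Fin.tail x)) + c := by
      refine h 0 _ _ fun j hj => ?_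
      obtain ⟨k, rfl⟩ := Fin.exists_succ_eq.2 hj
      rfl
    have h2 := oscillation_le_of_bounded_differences (c := c)
      (F := fun z : Fin n → X => F (Fin.cons (y 0) z)) (fun i u v huv => by
        refine h i.succ _ _ fun j hj => ?_
        cases j using Fin.cases with
        | zero => rfl
        | succ k => exact huv k fun e => hj (e ▸ rfl)) (Fin.tail x) (Fin.tail y)
    rw [Fin.cons_self_tail] at h2
    push_cast
    linarith

open ProbabilityTheory in
/-- McDiarmid's bounded differences inequality, in the form of a sub-Gaussian bound. -/
theorem hasSubgaussianMGF_of_bounded_differences {X : Type*} [MeasurableSpace X] (P : Measure X)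
    [IsProbabilityMeasure P] (c : ℝ≥0) : ∀ {n : ℕ} {F : (Fin n → X) → ℝ}, Measurable F →
      (∀ i x y, (∀ j, j ≠ i → x j = y j) → F x ≤ F y + c) →
      HasSubgaussianMGF (fun x => F x - ∫ y, F y ∂(Measure.pi fun _ => P)) (n * (c / 2) ^ 2)
        (Measure.pi fun _ => P)
  | 0, F, hF, h => by
    have : (fun x => F x - ∫ y, F y ∂(Measure.pi fun _ : Fin 0 => P)) = fun _ => 0 := by
      funext x
      have : F = fun _ => F x := funext fun y => by rw [Subsingleton.elim y x]
      rw [this]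
      simp
    rw [this]
    simp
  | n + 1, F, hF, h => by
    have hX : Nonempty X := nonempty_of_isProbabilityMeasure P
    obtain ⟨x₀⟩ := hX
    set e := MeasurableEquiv.piFinSuccAbove (fun _ : Fin (n + 1) => X) 0 with he
    have hmp : MeasurePreserving e (Measure.pi fun _ => P) (P.prod (Measure.pi fun _ => P)) :=
      measurePreserving_piFinSuccAbove (fun _ : Fin (n + 1) => P) 0
    have hes : ∀ a z, e.symm (a, z) = Fin.cons a z := fun a z => by
      simp [he, MeasurableEquiv.piFinSuccAbove]
      rfl
    have hG : Measurable (fun p => F (e.symm p)) := hF.comp e.symm.measurable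
    have hosc := oscillation_le_of_bounded_differences h
    have hK : ∀ p, |F (e.symm p)| ≤ |F fun _ => x₀| + (n + 1 : ℕ) * c := by
      intro p
      have h1 := hosc (e.symm p) fun _ => x₀
      have h2 := hosc (fun _ => x₀) (e.symm p)
      have h3 := le_abs_self (F fun _ => x₀)
      have h4 := neg_abs_le (F fun _ => x₀)
      exact abs_le.2 ⟨by linarith, by linarith⟩
    have hint : ∀ a, Integrable (fun z => F (e.symm (a, z))) (Measure.pi fun _ => P) := fun a =>
      Integrable.of_bound (hG.comp measurable_prodMk_left).aestronglyMeasurable _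
        (Filter.Eventually.of_forall fun z => hK (a, z))
    have h₁ : ∀ a, HasSubgaussianMGF
        (fun z => F (e.symm (a, z)) - ∫ z', F (e.symm (a, z')) ∂(Measure.pi fun _ => P))
        (n * (c / 2) ^ 2) (Measure.pi fun _ => P) := fun a => by
      refine hasSubgaussianMGF_of_bounded_differences P c
        (F := fun z => F (e.symm (a, z))) (hG.comp measurable_prodMk_left) fun i u v huv => ?_
      refine h i.succ _ _ fun j hj => ?_
      rw [hes, hes]
      cases j using Fin.cases with
      | zero => rfl
      | succ k => exact huv k fun e => hj (e ▸ rfl)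
    have h₂ : HasSubgaussianMGF (fun a => ∫ z, F (e.symm (a, z)) ∂(Measure.pi fun _ => P) -
        ∫ p, F (e.symm p) ∂(P.prod (Measure.pi fun _ => P))) ((c / 2) ^ 2) P := by
      rw [integral_prod _ (Integrable.of_bound hG.aestronglyMeasurable _
        (Filter.Eventually.of_forall hK))]
      refine hasSubgaussianMGF_of_oscillation P
        (g := fun a => ∫ z, F (e.symm (a, z)) ∂(Measure.pi fun _ => P))
        hG.stronglyMeasurable.integral_prod_right'.measurable fun a a' => ?_
      calc ∫ z, F (e.symm (a, z)) ∂(Measure.pi fun _ => P)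
          ≤ ∫ z, (F (e.symm (a', z)) + c) ∂(Measure.pi fun _ => P) := by
            refine integral_mono (hint a) ((hint a').add (integrable_const _)) fun z => ?_
            refine h 0 _ _ fun j hj => ?_
            obtain ⟨k, rfl⟩ := Fin.exists_succ_eq.2 hj
            rw [hes, hes]
            simp
        _ = _ := by
            rw [integral_add (hint a') (integrable_const _)]
            simp
    have key := hasSubgaussianMGF_prod P (Measure.pi fun _ : Fin n => P) hG hK h₁ h₂
    rw [← hmp.map_eq] at key
    have := HasSubgaussianMGF.of_map e.measurable.aemeasurable key
    rw [hmp.map_eq, ← hmp.integral_comp e.measurableEmbedding] at this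
    have hc : ((n + 1 : ℕ) : ℝ≥0) * (c / 2) ^ 2 = n * (c / 2) ^ 2 + (c / 2) ^ 2 := by
      push_cast
      ring
    rw [hc]
    simpa [Function.comp_def] using this

/-- McDiarmid's tail bound. The case `c = 0`, in which `F` is almost surely constant, is the reason
for the strict inequality. -/
lemma measure_lt_le_of_bounded_differences {X : Type*} [MeasurableSpace X] (P : Measure X)
    [IsProbabilityMeasure P] {n : ℕ} (hn : 0 < n) {c : ℝ≥0} {F : (Fin n → X) → ℝ}
    (hF : Measurable F) (h : ∀ i x y, (∀ j, j ≠ i → x j = y j) → F x ≤ F y + c)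
    (h0 : ∫ x, F x ∂(Measure.pi fun _ => P) ≤ 0) {L : ℝ} (hL : 0 ≤ L) :
    (Measure.pi fun _ => P) {x | n * c * √(L / (2 * n)) < F x} ≤ ENNReal.ofReal (Real.exp (-L)) := by
  have hsub := hasSubgaussianMGF_of_bounded_differences P c hF h
  rcases eq_or_ne c 0 with rfl | hc
  · have hz : (n : ℝ≥0) * (0 / 2) ^ 2 = 0 := by simp
    rw [hz] at hsub
    have hae := hsub.ae_eq_zero_of_hasSubgaussianMGF_zero
    have : (Measure.pi fun _ => P) {x | n * ((0 : ℝ≥0) : ℝ) * √(L / (2 * n)) < F x} = 0 := by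
      refine measure_mono_null (fun x hx => ?_) hae
      simp only [NNReal.coe_zero, mul_zero, zero_mul, Set.mem_ofPred_eq] at hx
      simp only [Set.mem_compl_iff, Set.mem_ofPred_eq, Pi.zero_apply]
      intro h'
      linarith
    rw [this]
    exact zero_le
  · have hn' : (0 : ℝ) < n := by exact_mod_cast hn
    have hc' : (0 : ℝ) < c := by exact_mod_cast pos_iff_ne_zero.2 hc
    have ht := hsub.measure_ge_le (ε := n * c * √(L / (2 * n))) (by positivity)
    have hexp : -(n * c * √(L / (2 * n))) ^ 2 / (2 * (((n : ℝ≥0) * (c / 2) ^ 2 : ℝ≥0) : ℝ)) = -L := by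
      rw [mul_pow, Real.sq_sqrt (by positivity)]
      push_cast
      field_simp
    rw [hexp] at ht
    rw [← ENNReal.ofReal_toReal (measure_ne_top (Measure.pi fun _ => P) _)]
    refine ENNReal.ofReal_le_ofReal (le_trans ?_ ht)
    refine measureReal_mono (fun x hx => ?_) (measure_ne_top _ _)
    simp only [Set.mem_ofPred_eq] at hx ⊢
    linarith

lemma coe_sum_ereal {ι : Type*} (s : Finset ι) (f : ι → ℝ) :
    ((∑ i ∈ s, f i : ℝ) : EReal) = ∑ i ∈ s, (f i : EReal) :=
  map_sum (⟨⟨Real.toEReal, EReal.coe_zero⟩, EReal.coe_add⟩ : ℝ →+ EReal) f s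

/-! ### Suprema of signed sums over a bounded class -/

section BoundedClass

variable {X : Type*} {G : Set (X → ℝ)} {M : ℝ}

lemma le_signedSup {g : X → ℝ} (hg : g ∈ G) {k : ℕ} (σ : Fin k → ℤˣ) (x : Fin k → X) :
    ((∑ i, ((σ i : ℤ) : ℝ) * g (x i) : ℝ) : EReal) ≤ signedSup G σ x :=
  le_iSup₂ (f := fun g (_ : g ∈ G) => ((∑ i, ((σ i : ℤ) : ℝ) * g (x i) : ℝ) : EReal)) g hg

lemma signedSup_le {k : ℕ} {σ : Fin k → ℤˣ} {x : Fin k → X} {C : EReal}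
    (h : ∀ g ∈ G, ((∑ i, ((σ i : ℤ) : ℝ) * g (x i) : ℝ) : EReal) ≤ C) : signedSup G σ x ≤ C :=
  iSup₂_le h

lemma signedSup_ne_bot (hne : G.Nonempty) {k : ℕ} (σ : Fin k → ℤˣ) (x : Fin k → X) :
    signedSup G σ x ≠ ⊥ := by
  obtain ⟨g, hg⟩ := hne
  exact ((EReal.bot_lt_coe _).trans_le (le_signedSup hg σ x)).ne'

lemma abs_coe_sign (s : ℤˣ) : |((s : ℤ) : ℝ)| = 1 := by
  rcases Int.units_eq_one_or s with rfl | rfl <;> simp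

lemma signedSup_ne_top (hb : ∀ g ∈ G, ∀ x, 0 ≤ g x ∧ g x ≤ M) {k : ℕ} (σ : Fin k → ℤˣ)
    (x : Fin k → X) : signedSup G σ x ≠ ⊤ := by
  refine ((signedSup_le (C := ((∑ _i : Fin k, M : ℝ) : EReal)) fun g hg => ?_).trans_lt
    (EReal.coe_lt_top _)).ne
  refine EReal.coe_le_coe_iff.2 (Finset.sum_le_sum fun i _ => ?_)
  calc ((σ i : ℤ) : ℝ) * g (x i) ≤ |((σ i : ℤ) : ℝ) * g (x i)| := le_abs_self _
    _ = g (x i) := by rw [abs_mul, abs_coe_sign, one_mul, abs_of_nonneg (hb g hg _).1]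
    _ ≤ M := (hb g hg _).2

lemma coe_toReal_signedSup (hne : G.Nonempty) (hb : ∀ g ∈ G, ∀ x, 0 ≤ g x ∧ g x ≤ M) {k : ℕ}
    (σ : Fin k → ℤˣ) (x : Fin k → X) :
    ((signedSup G σ x).toReal : EReal) = signedSup G σ x :=
  EReal.coe_toReal (signedSup_ne_top hb σ x) (signedSup_ne_bot hne σ x)

lemma le_toReal_signedSup (hb : ∀ g ∈ G, ∀ x, 0 ≤ g x ∧ g x ≤ M) {g : X → ℝ} (hg : g ∈ G) {k : ℕ}
    (σ : Fin k → ℤˣ) (x : Fin k → X) :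
    ∑ i, ((σ i : ℤ) : ℝ) * g (x i) ≤ (signedSup G σ x).toReal := by
  rw [← EReal.coe_le_coe_iff, coe_toReal_signedSup ⟨g, hg⟩ hb]
  exact le_signedSup hg σ x

lemma toReal_signedSup_le (hne : G.Nonempty) (hb : ∀ g ∈ G, ∀ x, 0 ≤ g x ∧ g x ≤ M) {k : ℕ}
    {σ : Fin k → ℤˣ} {x : Fin k → X} {C : ℝ}
    (h : ∀ g ∈ G, ∑ i, ((σ i : ℤ) : ℝ) * g (x i) ≤ C) : (signedSup G σ x).toReal ≤ C := by
  rw [← EReal.coe_le_coe_iff, coe_toReal_signedSup hne hb]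
  exact signedSup_le fun g hg => EReal.coe_le_coe_iff.2 (h g hg)

lemma abs_toReal_signedSup_le (hne : G.Nonempty) (hb : ∀ g ∈ G, ∀ x, 0 ≤ g x ∧ g x ≤ M) {k : ℕ}
    (σ : Fin k → ℤˣ) (x : Fin k → X) : |(signedSup G σ x).toReal| ≤ k * M := by
  have habs : ∀ g ∈ G, |∑ i, ((σ i : ℤ) : ℝ) * g (x i)| ≤ k * M := fun g hg => by
    refine (Finset.abs_sum_le_sum_abs _ _).trans ?_
    calc ∑ i, |((σ i : ℤ) : ℝ) * g (x i)| ≤ ∑ _i : Fin k, M :=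
          Finset.sum_le_sum fun i _ => by
            rw [abs_mul, abs_coe_sign, one_mul, abs_of_nonneg (hb g hg _).1]
            exact (hb g hg _).2
      _ = k * M := by simp
  refine abs_le.2 ⟨?_, toReal_signedSup_le hne hb fun g hg => (abs_le.1 (habs g hg)).2⟩
  obtain ⟨g, hg⟩ := hne
  exact (abs_le.1 (habs g hg)).1.trans (le_toReal_signedSup hb hg σ x)

lemma toReal_signedSup_le_add (hne : G.Nonempty) (hb : ∀ g ∈ G, ∀ x, 0 ≤ g x ∧ g x ≤ M) {k : ℕ}
    (σ : Fin k → ℤˣ) (i : Fin k) {x y : Fin k → X} (hxy : ∀ j, j ≠ i → x j = y j) :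
    (signedSup G σ x).toReal ≤ (signedSup G σ y).toReal + M := by
  refine toReal_signedSup_le hne hb fun g hg => ?_
  have h1 := le_toReal_signedSup hb hg σ y
  have h2 : ∑ j, ((σ j : ℤ) : ℝ) * g (x j) - ∑ j, ((σ j : ℤ) : ℝ) * g (y j) =
      ((σ i : ℤ) : ℝ) * (g (x i) - g (y i)) := by
    rw [← Finset.sum_sub_distrib, Finset.sum_eq_single i]
    · ring
    · intro j _ hj
      rw [hxy j hj, sub_self]
    · simp
  have h3 : ((σ i : ℤ) : ℝ) * (g (x i) - g (y i)) ≤ M := by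
    refine (le_abs_self _).trans ?_
    rw [abs_mul, abs_coe_sign, one_mul, abs_le]
    constructor <;> linarith [(hb g hg (x i)).1, (hb g hg (x i)).2, (hb g hg (y i)).1,
      (hb g hg (y i)).2]
  linarith

lemma empRademacher_eq_coe (hne : G.Nonempty) (hb : ∀ g ∈ G, ∀ x, 0 ≤ g x ∧ g x ≤ M) {m : ℕ}
    (S : Fin m → X) :
    empRademacher G S =
      ((2 / m * ((2 ^ m)⁻¹ * ∑ σ : Fin m → ℤˣ, (signedSup G σ S).toReal) : ℝ) : EReal) := by
  rw [empRademacher, EReal.coe_mul, EReal.coe_mul]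
  congr 2
  rw [coe_sum_ereal]
  exact Finset.sum_congr rfl fun σ _ => (coe_toReal_signedSup hne hb σ S).symm

lemma toReal_empRademacher (hne : G.Nonempty) (hb : ∀ g ∈ G, ∀ x, 0 ≤ g x ∧ g x ≤ M) {m : ℕ}
    (S : Fin m → X) : (empRademacher G S).toReal =
      2 / m * ((2 ^ m)⁻¹ * ∑ σ : Fin m → ℤˣ, (signedSup G σ S).toReal) := by
  rw [empRademacher_eq_coe hne hb, EReal.toReal_coe]

lemma coe_toReal_empRademacher (hne : G.Nonempty) (hb : ∀ g ∈ G, ∀ x, 0 ≤ g x ∧ g x ≤ M) {m : ℕ}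
    (S : Fin m → X) : ((empRademacher G S).toReal : EReal) = empRademacher G S := by
  rw [empRademacher_eq_coe hne hb, EReal.toReal_coe]

lemma toReal_empRademacher_le_add (hne : G.Nonempty) (hb : ∀ g ∈ G, ∀ x, 0 ≤ g x ∧ g x ≤ M)
    {m : ℕ} (i : Fin m) {S T : Fin m → X} (hST : ∀ j, j ≠ i → S j = T j) :
    (empRademacher G S).toReal ≤ (empRademacher G T).toReal + 2 * M / m := by
  rw [toReal_empRademacher hne hb, toReal_empRademacher hne hb]
  have h : ∑ σ : Fin m → ℤˣ, (signedSup G σ S).toReal ≤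
      ∑ σ : Fin m → ℤˣ, (signedSup G σ T).toReal + 2 ^ m * M := by
    calc ∑ σ : Fin m → ℤˣ, (signedSup G σ S).toReal
        ≤ ∑ σ : Fin m → ℤˣ, ((signedSup G σ T).toReal + M) :=
          Finset.sum_le_sum fun σ _ => toReal_signedSup_le_add hne hb σ i hST
      _ = _ := by simp [Finset.sum_add_distrib]
  calc 2 / (m : ℝ) * ((2 ^ m)⁻¹ * ∑ σ : Fin m → ℤˣ, (signedSup G σ S).toReal)
      ≤ 2 / m * ((2 ^ m)⁻¹ * (∑ σ : Fin m → ℤˣ, (signedSup G σ T).toReal + 2 ^ m * M)) := by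
        gcongr
    _ = _ := by
        field_simp

end BoundedClass

/-! ### Symmetrization -/

section Symmetrization

variable {X : Type*} {G : Set (X → ℝ)} {M : ℝ}

/-- The supremum `sup_{g ∈ G} ∑ᵢ σᵢ (g(xᵢ) - g(yᵢ))` for a pair of samples `p = (x, y)`, as a signed
supremum over the concatenated sample; this makes it measurable for a measurable class. -/
noncomputable def pairSup (G : Set (X → ℝ)) {m : ℕ} (σ : Fin m → ℤˣ)
    (p : (Fin m → X) × (Fin m → X)) : ℝ :=
  (signedSup G (Fin.append σ (-σ)) (Fin.append p.1 p.2)).toReal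

lemma sum_append_sign (g : X → ℝ) {m : ℕ} (σ : Fin m → ℤˣ) (x y : Fin m → X) :
    ∑ i, (((Fin.append σ (-σ) i : ℤˣ) : ℤ) : ℝ) * g (Fin.append x y i) =
      ∑ i, ((σ i : ℤ) : ℝ) * (g (x i) - g (y i)) := by
  rw [Fin.sum_univ_add, ← Finset.sum_add_distrib]
  refine Finset.sum_congr rfl fun i _ => ?_
  simp only [Fin.append_left, Fin.append_right, Pi.neg_apply, Units.val_neg, Int.cast_neg]
  ring

lemma le_pairSup (hb : ∀ g ∈ G, ∀ x, 0 ≤ g x ∧ g x ≤ M) {g : X → ℝ} (hg : g ∈ G) {m : ℕ}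
    (σ : Fin m → ℤˣ) (p : (Fin m → X) × (Fin m → X)) :
    ∑ i, ((σ i : ℤ) : ℝ) * (g (p.1 i) - g (p.2 i)) ≤ pairSup G σ p := by
  rw [← sum_append_sign]
  exact le_toReal_signedSup hb hg _ _

lemma pairSup_le_add (hne : G.Nonempty) (hb : ∀ g ∈ G, ∀ x, 0 ≤ g x ∧ g x ≤ M) {m : ℕ}
    (σ : Fin m → ℤˣ) (p : (Fin m → X) × (Fin m → X)) :
    pairSup G σ p ≤ (signedSup G σ p.1).toReal + (signedSup G (-σ) p.2).toReal := by
  refine toReal_signedSup_le hne hb fun g hg => ?_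
  have h1 := le_toReal_signedSup hb hg σ p.1
  have h2 := le_toReal_signedSup hb hg (-σ) p.2
  rw [Fin.sum_univ_add]
  simp only [Fin.append_left, Fin.append_right]
  linarith

lemma pairSup_swap {m : ℕ} (s : ℤˣ) (σ : Fin m → ℤˣ) (p : (Fin m → X) × (Fin m → X)) :
    pairSup G (fun _ => s) (fun i => if σ i = s then p.1 i else p.2 i,
      fun i => if σ i = s then p.2 i else p.1 i) = pairSup G σ p := by
  unfold pairSup signedSup
  congr 1
  refine iSup_congr fun g => iSup_congr fun _ => ?_
  rw [sum_append_sign, sum_append_sign]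
  congr 1
  refine Finset.sum_congr rfl fun i _ => ?_
  by_cases h : σ i = s
  · simp [h]
  · have : s = - σ i := by
      rcases Int.units_eq_one_or s with rfl | rfl <;>
        rcases Int.units_eq_one_or (σ i) with h' | h' <;> simp_all
    simp only [if_neg h]
    rw [this]
    push_cast
    ring

variable [MeasurableSpace X]

lemma measurable_pairSup (hG : IsMeasurableClass G) {m : ℕ} (σ : Fin m → ℤˣ) :
    Measurable (pairSup G σ) := by
  refine ((hG.2 (m + m) (Fin.append σ (-σ))).comp ?_).ereal_toReal
  refine measurable_pi_lambda _ fun i => ?_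
  refine Fin.addCases (fun j => ?_) (fun j => ?_) i
  · simp only [Fin.append_left]
    fun_prop
  · simp only [Fin.append_right]
    fun_prop

/-- Exchanging the `i`-th draws of two independent i.i.d. samples, for the `i` in any given set,
preserves their joint law. -/
lemma measurePreserving_swap_coordinates (P : Measure X) [IsProbabilityMeasure P] {m : ℕ}
    (q : Fin m → Prop) [DecidablePred q] :
    MeasurePreserving (fun p : (Fin m → X) × (Fin m → X) =>
        ((fun i => if q i then p.1 i else p.2 i, fun i => if q i then p.2 i else p.1 i) :
          (Fin m → X) × (Fin m → X)))
      ((Measure.pi fun _ => P).prod (Measure.pi fun _ => P))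
      ((Measure.pi fun _ => P).prod (Measure.pi fun _ => P)) := by
  have he := measurePreserving_arrowProdEquivProdArrow X X (Fin m) (fun _ => P) (fun _ => P)
  have hs : MeasurePreserving (fun (z : Fin m → X × X) i => if q i then z i else (z i).swap)
      (Measure.pi fun _ => P.prod P) (Measure.pi fun _ => P.prod P) := by
    refine measurePreserving_pi (f := fun i z => if q i then z else z.swap)
      (fun _ => P.prod P) (fun _ => P.prod P) fun i => ?_
    by_cases h : q i
    · simpa only [if_pos h] using! MeasurePreserving.id _
    · simpa only [if_neg h] using Measure.measurePreserving_swap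
  convert (he.comp hs).comp he.symm using 1
  funext p
  refine Prod.ext (funext fun i => ?_) (funext fun i => ?_) <;>
    by_cases h : q i <;>
    simp [h, MeasurableEquiv.arrowProdEquivProdArrow, Equiv.arrowProdEquivProdArrow]

lemma integrable_pairSup (P : Measure X) [IsProbabilityMeasure P] (hG : IsMeasurableClass G)
    (hne : G.Nonempty) (hb : ∀ g ∈ G, ∀ x, 0 ≤ g x ∧ g x ≤ M) {m : ℕ} (σ : Fin m → ℤˣ) :
    Integrable (pairSup G σ) ((Measure.pi fun _ => P).prod (Measure.pi fun _ => P)) :=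
  Integrable.of_bound (measurable_pairSup hG σ).aestronglyMeasurable _
    (Filter.Eventually.of_forall fun _ => abs_toReal_signedSup_le hne hb _ _)

lemma integrable_signedSup (P : Measure X) [IsProbabilityMeasure P] (hG : IsMeasurableClass G)
    (hne : G.Nonempty) (hb : ∀ g ∈ G, ∀ x, 0 ≤ g x ∧ g x ≤ M) {m : ℕ} (σ : Fin m → ℤˣ) :
    Integrable (fun S => (signedSup G σ S).toReal) (Measure.pi fun _ => P) :=
  Integrable.of_bound (hG.2 m σ).ereal_toReal.aestronglyMeasurable _
    (Filter.Eventually.of_forall fun _ => abs_toReal_signedSup_le hne hb _ _)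

/-- Since the joint law of the two samples is invariant under exchanges of coordinates, the
expectation of `pairSup G σ` does not depend on the signs. -/
lemma integral_pairSup_const (P : Measure X) [IsProbabilityMeasure P] (hG : IsMeasurableClass G)
    {m : ℕ} (s : ℤˣ) (σ : Fin m → ℤˣ) :
    ∫ p, pairSup G (fun _ => s) p ∂((Measure.pi fun _ : Fin m => P).prod (Measure.pi fun _ => P)) =
      ∫ p, pairSup G σ p ∂((Measure.pi fun _ => P).prod (Measure.pi fun _ => P)) := by
  have h := measurePreserving_swap_coordinates P fun i => σ i = s
  conv_lhs => rw [← h.map_eq]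
  rw [integral_map h.aemeasurable (measurable_pairSup hG _).aestronglyMeasurable]
  exact integral_congr_ae (Filter.Eventually.of_forall fun p => pairSup_swap s σ p)

lemma integral_pairSup_le (P : Measure X) [IsProbabilityMeasure P] (hG : IsMeasurableClass G)
    (hne : G.Nonempty) (hb : ∀ g ∈ G, ∀ x, 0 ≤ g x ∧ g x ≤ M) {m : ℕ} (s : ℤˣ) :
    (m : ℝ)⁻¹ * ∫ p, pairSup G (fun _ => s) p
        ∂((Measure.pi fun _ : Fin m => P).prod (Measure.pi fun _ => P)) ≤
      ∫ S : Fin m → X, (empRademacher G S).toReal ∂(Measure.pi fun _ => P) := by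
  set D := ∫ p, pairSup G (fun _ => s) p
        ∂((Measure.pi fun _ : Fin m => P).prod (Measure.pi fun _ => P)) with hD
  have hσ : ∀ σ : Fin m → ℤˣ, D ≤ ∫ S, (signedSup G σ S).toReal ∂(Measure.pi fun _ => P) +
      ∫ S, (signedSup G (-σ) S).toReal ∂(Measure.pi fun _ => P) := by
    intro σ
    have hi₁ : Integrable (fun p : (Fin m → X) × (Fin m → X) => (signedSup G σ p.1).toReal)
        ((Measure.pi fun _ => P).prod (Measure.pi fun _ => P)) :=
      (integrable_signedSup P hG hne hb σ).comp_fst _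
    have hi₂ : Integrable (fun p : (Fin m → X) × (Fin m → X) => (signedSup G (-σ) p.2).toReal)
        ((Measure.pi fun _ => P).prod (Measure.pi fun _ => P)) :=
      (integrable_signedSup P hG hne hb (-σ)).comp_snd _
    rw [hD, integral_pairSup_const P hG s σ]
    refine (integral_mono (integrable_pairSup P hG hne hb σ) (hi₁.add hi₂) fun p =>
      pairSup_le_add hne hb σ p).trans_eq ?_
    rw [integral_add' hi₁ hi₂]
    congr 1
    · simpa using integral_fun_fst (ν := Measure.pi fun _ : Fin m => P)
        fun S : Fin m → X => (signedSup G σ S).toReal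
    · simpa using integral_fun_snd (μ := Measure.pi fun _ : Fin m => P)
        fun S : Fin m → X => (signedSup G (-σ) S).toReal
  have hsum := Finset.sum_le_sum fun (σ : Fin m → ℤˣ) (_ : σ ∈ Finset.univ) => hσ σ
  have hneg := Equiv.sum_comp (Equiv.neg (Fin m → ℤˣ))
    (fun σ => ∫ S, (signedSup G σ S).toReal ∂(Measure.pi fun _ => P))
  simp only [Equiv.neg_apply] at hneg
  rw [Finset.sum_add_distrib, hneg] at hsum
  simp only [Finset.sum_const, Finset.card_univ, Fintype.card_pi, Fintype.card_units_int,
    Finset.prod_const, Fintype.card_fin, nsmul_eq_mul, Nat.cast_pow, Nat.cast_ofNat] at hsum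
  simp_rw [toReal_empRademacher hne hb]
  rw [integral_const_mul, integral_const_mul,
    integral_finsetSum _ fun σ _ => integrable_signedSup P hG hne hb σ]
  have h2 : (0 : ℝ) < 2 ^ m := by positivity
  set A := ∑ σ, ∫ S, (signedSup G σ S).toReal ∂(Measure.pi fun _ : Fin m => P)
  calc (m : ℝ)⁻¹ * D = (m : ℝ)⁻¹ * ((2 ^ m)⁻¹ * (2 ^ m * D)) := by field_simp
    _ ≤ (m : ℝ)⁻¹ * ((2 ^ m)⁻¹ * (A + A)) := by gcongr
    _ = _ := by ring

end Symmetrization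

/-! ### The one-sided uniform deviation bound -/

section UniformDeviation

variable {X : Type*} [MeasurableSpace X] {G : Set (X → ℝ)} {M : ℝ}

/-- The mean of `(1/m) sup_{g ∈ G} s ∑ᵢ (g(S'ᵢ) - g(Sᵢ))` over an independent ghost sample `S'`. It
dominates `sup_{g ∈ G} s (E g - (1/m) ∑ᵢ g(Sᵢ))` and is a measurable function of `S` whenever the
class is measurable in the sense of `IsMeasurableClass`. -/
noncomputable def ghostDeviation (P : Measure X) (G : Set (X → ℝ)) {m : ℕ} (s : ℤˣ)
    (S : Fin m → X) : ℝ :=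
  (m : ℝ)⁻¹ * ∫ S', pairSup G (fun _ => s) (S', S) ∂(Measure.pi fun _ => P)

variable (P : Measure X) [IsProbabilityMeasure P]

lemma measurable_ghostDeviation (hG : IsMeasurableClass G) {m : ℕ} (s : ℤˣ) :
    Measurable (ghostDeviation P G (m := m) s) :=
  ((measurable_pairSup hG fun _ => s).stronglyMeasurable.integral_prod_left'.measurable).const_mul _

lemma integrable_pairSup_left (hG : IsMeasurableClass G) (hne : G.Nonempty)
    (hb : ∀ g ∈ G, ∀ x, 0 ≤ g x ∧ g x ≤ M) {m : ℕ} (σ : Fin m → ℤˣ) (S : Fin m → X) :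
    Integrable (fun S' => pairSup G σ (S', S)) (Measure.pi fun _ => P) :=
  Integrable.of_bound ((measurable_pairSup hG σ).comp measurable_prodMk_right).aestronglyMeasurable
    _ (Filter.Eventually.of_forall fun _ => abs_toReal_signedSup_le hne hb _ _)

lemma integrable_of_mem_class (hG : IsMeasurableClass G) (hb : ∀ g ∈ G, ∀ x, 0 ≤ g x ∧ g x ≤ M)
    {g : X → ℝ} (hg : g ∈ G) : Integrable g P :=
  Integrable.of_bound (hG.1 g hg).aestronglyMeasurable M (Filter.Eventually.of_forall fun x => by
    rw [Real.norm_eq_abs, abs_of_nonneg (hb g hg x).1]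
    exact (hb g hg x).2)

lemma deviation_le_ghostDeviation (hG : IsMeasurableClass G)
    (hb : ∀ g ∈ G, ∀ x, 0 ≤ g x ∧ g x ≤ M) {m : ℕ} (hm : 0 < m) (s : ℤˣ) (S : Fin m → X)
    {g : X → ℝ} (hg : g ∈ G) :
    ((s : ℤ) : ℝ) * (∫ x, g x ∂P - (m : ℝ)⁻¹ * ∑ i, g (S i)) ≤ ghostDeviation P G s S := by
  have hm' : (0 : ℝ) < m := by exact_mod_cast hm
  have heval : ∀ i, Integrable (fun S' : Fin m → X => g (S' i)) (Measure.pi fun _ => P) := fun i =>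
    (measurePreserving_eval (fun _ : Fin m => P) i).integrable_comp_of_integrable
      (integrable_of_mem_class P hG hb hg)
  have hmean : ∀ i, ∫ S' : Fin m → X, g (S' i) ∂(Measure.pi fun _ => P) = ∫ x, g x ∂P := fun i => by
    have h := measurePreserving_eval (fun _ : Fin m => P) i
    conv_rhs => rw [← h.map_eq]
    rw [integral_map h.aemeasurable (hG.1 g hg).aestronglyMeasurable]
  have hterm : ∀ i, Integrable (fun S' : Fin m → X => ((s : ℤ) : ℝ) * (g (S' i) - g (S i)))
      (Measure.pi fun _ => P) := fun i => ((heval i).sub (integrable_const _)).const_mul _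
  have hle : ((s : ℤ) : ℝ) * (m * ∫ x, g x ∂P - ∑ i, g (S i)) ≤
      ∫ S', pairSup G (fun _ => s) (S', S) ∂(Measure.pi fun _ => P) := by
    calc ((s : ℤ) : ℝ) * (m * ∫ x, g x ∂P - ∑ i, g (S i))
        = ∫ S' : Fin m → X, ∑ i, ((s : ℤ) : ℝ) * (g (S' i) - g (S i)) ∂(Measure.pi fun _ => P) := by
          rw [integral_finsetSum _ fun i _ => hterm i]
          simp_rw [integral_const_mul, integral_sub (heval _) (integrable_const _), hmean]
          rw [← Finset.mul_sum, Finset.sum_sub_distrib]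
          simp
      _ ≤ _ := integral_mono (integrable_finsetSum _ fun i _ => hterm i)
          (integrable_pairSup_left P hG ⟨g, hg⟩ hb _ S) fun S' =>
            le_pairSup hb hg (fun _ => s) (S', S)
  calc ((s : ℤ) : ℝ) * (∫ x, g x ∂P - (m : ℝ)⁻¹ * ∑ i, g (S i))
      = (m : ℝ)⁻¹ * (((s : ℤ) : ℝ) * (m * ∫ x, g x ∂P - ∑ i, g (S i))) := by field_simp
    _ ≤ _ := mul_le_mul_of_nonneg_left hle (by positivity)

lemma ghostDeviation_le_add (hG : IsMeasurableClass G) (hne : G.Nonempty)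
    (hb : ∀ g ∈ G, ∀ x, 0 ≤ g x ∧ g x ≤ M) {m : ℕ} (s : ℤˣ) (i : Fin m) {S T : Fin m → X}
    (hST : ∀ j, j ≠ i → S j = T j) : ghostDeviation P G s S ≤ ghostDeviation P G s T + M / m := by
  have h : ∫ S', pairSup G (fun _ => s) (S', S) ∂(Measure.pi fun _ => P) ≤
      ∫ S', pairSup G (fun _ => s) (S', T) ∂(Measure.pi fun _ => P) + M := by
    calc ∫ S', pairSup G (fun _ => s) (S', S) ∂(Measure.pi fun _ => P)
        ≤ ∫ S', (pairSup G (fun _ => s) (S', T) + M) ∂(Measure.pi fun _ => P) := by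
          refine integral_mono (integrable_pairSup_left P hG hne hb _ S)
            ((integrable_pairSup_left P hG hne hb _ T).add (integrable_const _)) fun S' => ?_
          refine toReal_signedSup_le_add hne hb _ (Fin.natAdd m i) fun j hj => ?_
          cases j using Fin.addCases with
          | left k => simp only [Fin.append_left]
          | right k =>
            simp only [Fin.append_right]
            exact hST k fun e => hj (e ▸ rfl)
      _ = _ := by
          rw [integral_add (integrable_pairSup_left P hG hne hb _ T) (integrable_const _)]
          simp
  calc ghostDeviation P G s S
      ≤ (m : ℝ)⁻¹ * (∫ S', pairSup G (fun _ => s) (S', T) ∂(Measure.pi fun _ => P) + M) :=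
        mul_le_mul_of_nonneg_left h (by positivity)
    _ = _ := by rw [ghostDeviation]; ring

lemma measurable_toReal_empRademacher (hG : IsMeasurableClass G) (hne : G.Nonempty)
    (hb : ∀ g ∈ G, ∀ x, 0 ≤ g x ∧ g x ≤ M) {m : ℕ} :
    Measurable fun S : Fin m → X => (empRademacher G S).toReal := by
  simp_rw [toReal_empRademacher hne hb]
  exact ((Finset.measurable_fun_sum _ fun σ _ => (hG.2 m σ).ereal_toReal).const_mul _).const_mul _

lemma integrable_toReal_empRademacher (hG : IsMeasurableClass G) (hne : G.Nonempty)
    (hb : ∀ g ∈ G, ∀ x, 0 ≤ g x ∧ g x ≤ M) {m : ℕ} :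
    Integrable (fun S : Fin m → X => (empRademacher G S).toReal) (Measure.pi fun _ => P) := by
  simp_rw [toReal_empRademacher hne hb]
  exact ((integrable_finsetSum _ fun σ _ =>
    integrable_signedSup P hG hne hb σ).const_mul _).const_mul _

/-- The deviation in one direction `s` exceeds the empirical Rademacher complexity by more than
`3M √(L / (2m))` with probability at most `exp (-L)`. The bounded differences inequality is applied
to the difference of the two quantities, so that a single exceptional event covers both the
deviation and the passage from the expected to the empirical Rademacher complexity. -/
theorem exists_event_deviation_le (hG : IsMeasurableClass G) (hne : G.Nonempty)
    (hb : ∀ g ∈ G, ∀ x, 0 ≤ g x ∧ g x ≤ M) (hM : 0 ≤ M) {m : ℕ} (hm : 0 < m) (s : ℤˣ) {L : ℝ}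
    (hL : 0 ≤ L) :
    ∃ B : Set (Fin m → X), MeasurableSet B ∧
      (Measure.pi fun _ => P) B ≤ ENNReal.ofReal (Real.exp (-L)) ∧
      ∀ S ∉ B, ∀ g ∈ G, ((s : ℤ) : ℝ) * (∫ x, g x ∂P - (m : ℝ)⁻¹ * ∑ i, g (S i)) ≤
        (empRademacher G S).toReal + 3 * M * √(L / (2 * m)) := by
  have hm' : (0 : ℝ) < m := by exact_mod_cast hm
  set F : (Fin m → X) → ℝ := fun S => ghostDeviation P G s S - (empRademacher G S).toReal with hF
  have hFm : Measurable F :=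
    (measurable_ghostDeviation P hG s).sub (measurable_toReal_empRademacher hG hne hb)
  have hc : (((3 * M / m).toNNReal : ℝ≥0) : ℝ) = 3 * M / m := Real.coe_toNNReal _ (by positivity)
  have hdiff : ∀ i S T, (∀ j, j ≠ i → S j = T j) → F S ≤ F T + (3 * M / m).toNNReal := by
    intro i S T hST
    have h1 := ghostDeviation_le_add P hG hne hb s i hST
    have h2 := toReal_empRademacher_le_add hne hb i fun j hj => (hST j hj).symm
    have h3 : 3 * M / m = M / m + 2 * M / m := by ring
    rw [hc, h3]
    simp only [hF]
    linarith
  have hint : Integrable (fun S : Fin m → X => ghostDeviation P G s S) (Measure.pi fun _ => P) :=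
    ((integrable_pairSup P hG hne hb fun _ => s).integral_prod_right).const_mul _
  have h0 : ∫ S, F S ∂(Measure.pi fun _ => P) ≤ 0 := by
    rw [hF, integral_sub hint (integrable_toReal_empRademacher P hG hne hb), sub_nonpos]
    refine le_trans (le_of_eq ?_) (integral_pairSup_le P hG hne hb s)
    rw [integral_prod_symm _ (integrable_pairSup P hG hne hb fun _ => s), ← integral_const_mul]
    rfl
  refine ⟨_, measurableSet_lt measurable_const hFm,
    measure_lt_le_of_bounded_differences P hm hFm hdiff h0 hL, fun S hS g hg => ?_⟩
  have h1 := deviation_le_ghostDeviation P hG hb hm s S hg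
  have h2 : (m : ℝ) * (3 * M / m) = 3 * M := by field_simp
  simp only [Set.mem_ofPred_eq, not_lt, hF, hc, h2] at hS
  linarith

end UniformDeviation

/-! ### The contraction principle -/

/-- The contraction principle for averages over signs. The suprema over the index set are replaced
on the left by an arbitrary selection `c` and on the right by arbitrary upper bounds `B`, which
makes the statement meaningful for unbounded families. The coordinates are treated one by one; the
terms `a i` collect those for which `φ` has already been removed. -/
lemma sum_contraction_le {ι : Type*} {φ : ℝ → ℝ} {L : ℝ} (hφ : ∀ u v, φ u - φ v ≤ L * |u - v|) :
    ∀ {k : ℕ} (a : ι → ℝ) (x : ι → Fin k → ℝ) (B : (Fin k → ℤˣ) → ℝ),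
      (∀ σ i, a i + L * ∑ j, ((σ j : ℤ) : ℝ) * x i j ≤ B σ) → ∀ c : (Fin k → ℤˣ) → ι,
        ∑ σ, (a (c σ) + ∑ j, ((σ j : ℤ) : ℝ) * φ (x (c σ) j)) ≤ ∑ σ, B σ
  | 0, a, x, B, hB, c => by
    refine Finset.sum_le_sum fun σ _ => ?_
    simpa using hB σ (c σ)
  | k + 1, a, x, B, hB, c => by
    have hcons : ∀ f : (Fin (k + 1) → ℤˣ) → ℝ,
        ∑ σ, f σ = ∑ σ : Fin k → ℤˣ, (f (Fin.cons 1 σ) + f (Fin.cons (-1) σ)) := by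
      intro f
      rw [← Equiv.sum_comp (Fin.consEquiv fun _ => ℤˣ) f, Fintype.sum_prod_type_right]
      refine Finset.sum_congr rfl fun σ _ => ?_
      rw [UnitsInt.univ, Finset.sum_pair (by decide)]
      rfl
    rw [hcons, hcons B]
    -- The two sign vectors that differ in the first sign only are treated together: in one of the
    -- two orders, the pair of selected indices also works with `L * x i 0` in place of `φ (x i 0)`.
    have hpair : ∀ σ : Fin k → ℤˣ, ∃ d : ι × ι,
        (a (c (Fin.cons 1 σ)) + (φ (x (c (Fin.cons 1 σ)) 0) +
            ∑ j : Fin k, ((σ j : ℤ) : ℝ) * φ (x (c (Fin.cons 1 σ)) j.succ))) +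
          (a (c (Fin.cons (-1) σ)) + (-φ (x (c (Fin.cons (-1) σ)) 0) +
            ∑ j : Fin k, ((σ j : ℤ) : ℝ) * φ (x (c (Fin.cons (-1) σ)) j.succ))) ≤
        ((a d.1 + L * x d.1 0) + ∑ j : Fin k, ((σ j : ℤ) : ℝ) * φ (x d.1 j.succ)) +
          ((a d.2 - L * x d.2 0) + ∑ j : Fin k, ((σ j : ℤ) : ℝ) * φ (x d.2 j.succ)) := by
      intro σ
      have h := hφ (x (c (Fin.cons 1 σ)) 0) (x (c (Fin.cons (-1) σ)) 0)
      rcases le_total (x (c (Fin.cons (-1) σ)) 0) (x (c (Fin.cons 1 σ)) 0) with hle | hle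
      · refine ⟨(c (Fin.cons 1 σ), c (Fin.cons (-1) σ)), ?_⟩
        rw [abs_of_nonneg (sub_nonneg.2 hle)] at h
        linarith
      · refine ⟨(c (Fin.cons (-1) σ), c (Fin.cons 1 σ)), ?_⟩
        rw [abs_of_nonpos (sub_nonpos.2 hle)] at h
        linarith
    choose d hd using hpair
    have h₁ := sum_contraction_le hφ (fun i => a i + L * x i 0) (fun i j => x i j.succ)
      (fun σ => B (Fin.cons 1 σ)) (fun σ i => by
        have := hB (Fin.cons 1 σ) i
        simp only [Fin.sum_univ_succ, Fin.cons_zero, Fin.cons_succ, Units.val_one,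
          Int.cast_one] at this
        linarith) fun σ => (d σ).1
    have h₂ := sum_contraction_le hφ (fun i => a i - L * x i 0) (fun i j => x i j.succ)
      (fun σ => B (Fin.cons (-1) σ)) (fun σ i => by
        have := hB (Fin.cons (-1) σ) i
        simp only [Fin.sum_univ_succ, Fin.cons_zero, Fin.cons_succ, Units.val_neg, Units.val_one,
          Int.cast_neg, Int.cast_one] at this
        linarith) fun σ => (d σ).2
    refine le_trans ?_ ((add_le_add h₁ h₂).trans_eq Finset.sum_add_distrib.symm)
    rw [← Finset.sum_add_distrib]
    refine Finset.sum_le_sum fun σ _ => ?_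
    simpa [Fin.sum_univ_succ] using hd σ

section RademacherOfLoss

variable {X : Type*}

lemma nonempty_lossClass {Y : Type*} {H : Set (X → Y)} {ℓ : Y → Y → ℝ} (hne : H.Nonempty) :
    (lossClass H ℓ).Nonempty := by
  obtain ⟨h, hh⟩ := hne
  exact ⟨_, h, hh, h, hh, rfl⟩

lemma lossClass_bounds {Y : Type*} {H : Set (X → Y)} {ℓ : Y → Y → ℝ} {M : ℝ}
    (hb : ∀ h ∈ H, ∀ h' ∈ H, ∀ x, 0 ≤ ℓ (h x) (h' x) ∧ ℓ (h x) (h' x) ≤ M) :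
    ∀ g ∈ lossClass H ℓ, ∀ x, 0 ≤ g x ∧ g x ≤ M := by
  rintro _ ⟨h, hh, h', hh', rfl⟩ x
  exact hb h hh h' hh' x

lemma sum_sign_mul_eq_zero {m : ℕ} (y : Fin m → ℝ) :
    ∑ σ : Fin m → ℤˣ, ∑ i, ((σ i : ℤ) : ℝ) * y i = 0 := by
  have h := Equiv.sum_comp (Equiv.neg (Fin m → ℤˣ)) fun σ => ∑ i, ((σ i : ℤ) : ℝ) * y i
  simp only [Equiv.neg_apply, Pi.neg_apply, Units.val_neg, Int.cast_neg, neg_mul,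
    Finset.sum_neg_distrib] at h
  linarith

lemma empRademacher_nonneg {G : Set (X → ℝ)} (hne : G.Nonempty) {m : ℕ} (S : Fin m → X) :
    0 ≤ empRademacher G S := by
  obtain ⟨g, hg⟩ := hne
  have h : (0 : EReal) ≤ ∑ σ : Fin m → ℤˣ, signedSup G σ S := by
    rw [← EReal.coe_zero, ← sum_sign_mul_eq_zero fun i => g (S i), coe_sum_ereal]
    exact Finset.sum_le_sum fun σ _ => le_signedSup hg σ S
  exact mul_nonneg (EReal.coe_nonneg.2 (by positivity))
    (mul_nonneg (EReal.coe_nonneg.2 (by positivity)) h)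

lemma empRademacher_eq_top {G : Set (X → ℝ)} (hne : G.Nonempty) {m : ℕ} (hm : 0 < m)
    {S : Fin m → X} {σ : Fin m → ℤˣ} (h : signedSup G σ S = ⊤) : empRademacher G S = ⊤ := by
  have hm' : (0 : ℝ) < m := by exact_mod_cast hm
  have hsum : ∑ τ : Fin m → ℤˣ, signedSup G τ S = ⊤ := by
    rw [← Finset.add_sum_erase _ _ (Finset.mem_univ σ), h]
    refine EReal.top_add_of_ne_bot (Finset.sum_induction _ (· ≠ ⊥) ?_ ?_ fun τ _ =>
      signedSup_ne_bot hne τ S)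
    · intro a b ha hb
      simp [EReal.add_eq_bot_iff, ha, hb]
    · simp
  rw [empRademacher, hsum, EReal.coe_mul_top_of_pos (by positivity),
    EReal.coe_mul_top_of_pos (by positivity)]

/-- The bound on the Rademacher average of the loss class that results from the contraction
principle, for any upper bounds `B` on the signed sums of `q (h - h')`. -/
lemma sum_signedSup_lossClass_le {H : Set (X → ℝ)} {ℓ : ℝ → ℝ → ℝ} {q : ℝ≥0} {M : ℝ}
    (hne : H.Nonempty) (hb : ∀ g ∈ lossClass H ℓ, ∀ x, 0 ≤ g x ∧ g x ≤ M) {f : ℝ → ℝ}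
    (hf : LipschitzWith q f) (hℓ : ∀ h ∈ H, ∀ h' ∈ H, ∀ x, ℓ (h x) (h' x) = f (h x - h' x))
    {m : ℕ} (S : Fin m → X) (B : (Fin m → ℤˣ) → ℝ)
    (hB : ∀ σ, ∀ h ∈ H, ∀ h' ∈ H,
      q * ∑ i, ((σ i : ℤ) : ℝ) * (h (S i) - h' (S i)) ≤ B σ) :
    ∑ σ, (signedSup (lossClass H ℓ) σ S).toReal ≤ ∑ σ, B σ := by
  have hne' := nonempty_lossClass (ℓ := ℓ) hne
  have hφ : ∀ u v, f u - f v ≤ q * |u - v| := fun u v => by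
    have := hf.dist_le_mul u v
    rw [Real.dist_eq, Real.dist_eq] at this
    exact (le_abs_self _).trans this
  refine le_of_forall_pos_le_add fun ε hε => ?_
  have hN : (0 : ℝ) < 2 ^ m := by positivity
  have hsel : ∀ σ : Fin m → ℤˣ, ∃ p : H × H, (signedSup (lossClass H ℓ) σ S).toReal ≤
      ∑ i, ((σ i : ℤ) : ℝ) * f (p.1.1 (S i) - p.2.1 (S i)) + ε / 2 ^ m := by
    intro σ
    by_contra! hcon
    have hle : (signedSup (lossClass H ℓ) σ S).toReal ≤
        (signedSup (lossClass H ℓ) σ S).toReal - ε / 2 ^ m := by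
      refine toReal_signedSup_le hne' hb ?_
      rintro _ ⟨h, hh, h', hh', rfl⟩
      have := hcon (⟨h, hh⟩, ⟨h', hh'⟩)
      simp only [hℓ h hh h' hh']
      linarith
    have : 0 < ε / 2 ^ m := by positivity
    linarith
  choose c hc using hsel
  have key := sum_contraction_le hφ (fun _ : H × H => 0) (fun p i => p.1.1 (S i) - p.2.1 (S i)) B
    (fun σ p => by simpa using hB σ p.1.1 p.1.2 p.2.1 p.2.2) c
  simp only [zero_add] at key
  calc ∑ σ, (signedSup (lossClass H ℓ) σ S).toReal
      ≤ ∑ σ, (∑ i, ((σ i : ℤ) : ℝ) * f ((c σ).1.1 (S i) - (c σ).2.1 (S i)) + ε / 2 ^ m) :=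
        Finset.sum_le_sum fun σ _ => hc σ
    _ = ∑ σ, ∑ i, ((σ i : ℤ) : ℝ) * f ((c σ).1.1 (S i) - (c σ).2.1 (S i)) + ε := by
        rw [Finset.sum_add_distrib]
        simp
        field_simp
    _ ≤ _ := by gcongr

/-- For a loss that is a `q`-Lipschitz function of `h - h'`, contraction gives the factor `q`, and
separating the suprema over `h` and `h'` a factor `2`; the remaining factor `2` is not needed. -/
theorem empRademacher_lossClass_le {H : Set (X → ℝ)} {ℓ : ℝ → ℝ → ℝ} {q : ℝ≥0} {M : ℝ}
    (hne : H.Nonempty) (hb : ∀ g ∈ lossClass H ℓ, ∀ x, 0 ≤ g x ∧ g x ≤ M) {f : ℝ → ℝ}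
    (hf : LipschitzWith q f) (hℓ : ∀ h ∈ H, ∀ h' ∈ H, ∀ x, ℓ (h x) (h' x) = f (h x - h' x))
    {m : ℕ} (hm : 0 < m) (S : Fin m → X) :
    empRademacher (lossClass H ℓ) S ≤ ((4 * (q : ℝ) : ℝ) : EReal) * empRademacher H S := by
  have hne' := nonempty_lossClass (ℓ := ℓ) hne
  rcases eq_or_ne q 0 with rfl | hq
  · have h := sum_signedSup_lossClass_le hne hb hf hℓ S (fun _ => 0) (by simp)
    rw [empRademacher_eq_coe hne' hb]
    simp only [NNReal.coe_zero, mul_zero, EReal.coe_zero, zero_mul]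
    refine EReal.coe_nonpos.2 (mul_nonpos_of_nonneg_of_nonpos (by positivity)
      (mul_nonpos_of_nonneg_of_nonpos (by positivity) (h.trans_eq (by simp))))
  have hq' : (0 : ℝ) < q := by exact_mod_cast pos_iff_ne_zero.2 hq
  by_cases htop : ∃ σ, signedSup H σ S = ⊤
  · obtain ⟨σ, hσ⟩ := htop
    rw [empRademacher_eq_top hne hm hσ, EReal.coe_mul_top_of_pos (by positivity)]
    exact le_top
  push Not at htop
  have hcoe : ∀ σ, ((signedSup H σ S).toReal : EReal) = signedSup H σ S := fun σ =>
    EReal.coe_toReal (htop σ) (signedSup_ne_bot hne σ S)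
  have hle : ∀ σ, ∀ h ∈ H, ∑ i, ((σ i : ℤ) : ℝ) * h (S i) ≤ (signedSup H σ S).toReal :=
    fun σ h hh => by
      rw [← EReal.coe_le_coe_iff, hcoe]
      exact le_signedSup hh σ S
  have hsum := sum_signedSup_lossClass_le hne hb hf hℓ S
    (fun σ => q * ((signedSup H σ S).toReal + (signedSup H (-σ) S).toReal))
    fun σ h hh h' hh' => by
      have h1 := hle σ h hh
      have h2 := hle (-σ) h' hh'
      simp only [Pi.neg_apply, Units.val_neg, Int.cast_neg, neg_mul,
        Finset.sum_neg_distrib] at h2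
      simp only [mul_sub, Finset.sum_sub_distrib]
      rw [← mul_sub]
      exact mul_le_mul_of_nonneg_left (by linarith) hq'.le
  have hneg := Equiv.sum_comp (Equiv.neg (Fin m → ℤˣ)) fun σ => (signedSup H σ S).toReal
  simp only [Equiv.neg_apply] at hneg
  rw [← Finset.mul_sum, Finset.sum_add_distrib, hneg] at hsum
  have hR : empRademacher H S =
      ((2 / m * ((2 ^ m)⁻¹ * ∑ σ : Fin m → ℤˣ, (signedSup H σ S).toReal) : ℝ) : EReal) := by
    rw [EReal.coe_mul, EReal.coe_mul, coe_sum_ereal, empRademacher]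
    simp_rw [hcoe]
  have h0 := empRademacher_nonneg hne S
  rw [hR, EReal.coe_nonneg] at h0
  rw [hR, empRademacher_eq_coe hne' hb, ← EReal.coe_mul, EReal.coe_le_coe_iff]
  set R := ∑ σ : Fin m → ℤˣ, (signedSup H σ S).toReal
  calc 2 / (m : ℝ) * ((2 ^ m)⁻¹ * ∑ σ, (signedSup (lossClass H ℓ) σ S).toReal)
      ≤ 2 / (m : ℝ) * ((2 ^ m)⁻¹ * (q * (R + R))) := by gcongr
    _ = 2 * q * (2 / m * ((2 ^ m)⁻¹ * R)) := by ring
    _ ≤ 4 * q * (2 / m * ((2 ^ m)⁻¹ * R)) := by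
        gcongr
        norm_num

end RademacherOfLoss

/-! ### Discrepancies of empirical distributions -/

section Discrepancy

variable {X Y : Type*} [MeasurableSpace X]

lemma isProbabilityMeasure_empiricalDist {m : ℕ} (hm : 0 < m) (S : Fin m → X) :
    IsProbabilityMeasure (empiricalDist S) := by
  refine ⟨?_⟩
  have h : (m : ℝ≥0∞) ≠ 0 := by exact_mod_cast hm.ne'
  simp [empiricalDist, ENNReal.inv_mul_cancel h (ENNReal.natCast_ne_top m)]

lemma integral_empiricalDist {m : ℕ} (S : Fin m → X) {g : X → ℝ} (hg : Measurable g) :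
    ∫ x, g x ∂(empiricalDist S) = (m : ℝ)⁻¹ * ∑ i, g (S i) := by
  rw [empiricalDist, integral_smul_measure, integral_finsetSum_measure fun i _ =>
    integrable_dirac' hg.stronglyMeasurable (by simp)]
  simp [integral_dirac' _ _ hg.stronglyMeasurable]

variable {H : Set (X → Y)} {ℓ : Y → Y → ℝ} {M : ℝ}

lemma bddAbove_disc (hb : ∀ h ∈ H, ∀ h' ∈ H, ∀ x, 0 ≤ ℓ (h x) (h' x) ∧ ℓ (h x) (h' x) ≤ M)
    (P Q : Measure X) [IsProbabilityMeasure P] [IsProbabilityMeasure Q] :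
    BddAbove {r : ℝ | ∃ h ∈ H, ∃ h' ∈ H,
      r = |(∫ x, ℓ (h x) (h' x) ∂P) - (∫ x, ℓ (h x) (h' x) ∂Q)|} := by
  refine ⟨M + M, ?_⟩
  rintro _ ⟨h, hh, h', hh', rfl⟩
  have hI : ∀ (μ : Measure X) [IsProbabilityMeasure μ], |∫ x, ℓ (h x) (h' x) ∂μ| ≤ M := by
    intro μ _
    have := norm_integral_le_of_norm_le_const (μ := μ) (C := M)
      (f := fun x => ℓ (h x) (h' x)) (Filter.Eventually.of_forall fun x => by
        rw [Real.norm_eq_abs, abs_of_nonneg (hb h hh h' hh' x).1]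
        exact (hb h hh h' hh' x).2)
    simpa using this
  exact (abs_sub _ _).trans (add_le_add (hI P) (hI Q))

lemma disc_le_disc_add (hne : H.Nonempty) {P Q P' Q' : Measure X}
    (hbd : BddAbove {r : ℝ | ∃ h ∈ H, ∃ h' ∈ H,
      r = |(∫ x, ℓ (h x) (h' x) ∂P') - (∫ x, ℓ (h x) (h' x) ∂Q')|}) {a b : ℝ}
    (ha : ∀ g ∈ lossClass H ℓ, |∫ x, g x ∂P - ∫ x, g x ∂P'| ≤ a)
    (hb : ∀ g ∈ lossClass H ℓ, |∫ x, g x ∂Q - ∫ x, g x ∂Q'| ≤ b) :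
    disc H ℓ P Q ≤ disc H ℓ P' Q' + (a + b) := by
  obtain ⟨h₀, hh₀⟩ := hne
  refine csSup_le ⟨_, h₀, hh₀, h₀, hh₀, rfl⟩ ?_
  rintro _ ⟨h, hh, h', hh', rfl⟩
  have h1 := abs_le.1 (ha _ ⟨h, hh, h', hh', rfl⟩)
  have h2 := abs_le.1 (hb _ ⟨h, hh, h', hh', rfl⟩)
  have h3 : |(∫ x, ℓ (h x) (h' x) ∂P') - (∫ x, ℓ (h x) (h' x) ∂Q')| ≤ disc H ℓ P' Q' :=
    le_csSup hbd ⟨h, hh, h', hh', rfl⟩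
  have h4 := abs_le.1 h3
  exact abs_le.2 ⟨by linarith, by linarith⟩

lemma abs_disc_sub_disc_le (hne : H.Nonempty)
    (hbd : ∀ h ∈ H, ∀ h' ∈ H, ∀ x, 0 ≤ ℓ (h x) (h' x) ∧ ℓ (h x) (h' x) ≤ M)
    (P Q P' Q' : Measure X) [IsProbabilityMeasure P] [IsProbabilityMeasure Q]
    [IsProbabilityMeasure P'] [IsProbabilityMeasure Q'] {a b : ℝ}
    (ha : ∀ g ∈ lossClass H ℓ, |∫ x, g x ∂P - ∫ x, g x ∂P'| ≤ a)
    (hb : ∀ g ∈ lossClass H ℓ, |∫ x, g x ∂Q - ∫ x, g x ∂Q'| ≤ b) :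
    |disc H ℓ P Q - disc H ℓ P' Q'| ≤ a + b := by
  have h1 := disc_le_disc_add hne (bddAbove_disc hbd P' Q') ha hb
  have h2 := disc_le_disc_add hne (bddAbove_disc hbd P Q)
    (fun g hg => by rw [abs_sub_comm]; exact ha g hg)
    (fun g hg => by rw [abs_sub_comm]; exact hb g hg)
  exact abs_le.2 ⟨by linarith, by linarith⟩

/-- The two-sided uniform deviation bound for one sample, from the events for the two signs. -/
lemma exists_event_abs_deviation_le (P : Measure X) [IsProbabilityMeasure P] {G : Set (X → ℝ)}
    (hG : IsMeasurableClass G) (hne : G.Nonempty) (hb : ∀ g ∈ G, ∀ x, 0 ≤ g x ∧ g x ≤ M)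
    (hM : 0 ≤ M) {m : ℕ} (hm : 0 < m) {δ : ℝ} (hδ : 0 < δ) (hδ1 : δ < 1) :
    ∃ B : Set (Fin m → X), MeasurableSet B ∧
      (Measure.pi fun _ => P) B ≤ ENNReal.ofReal (δ / 2) ∧
      ∀ S ∉ B, ∀ g ∈ G, |∫ x, g x ∂P - ∫ x, g x ∂(empiricalDist S)| ≤
        (empRademacher G S).toReal + 3 * M * √(Real.log (4 / δ) / (2 * m)) := by
  have hL : 0 ≤ Real.log (4 / δ) := Real.log_nonneg (by rw [le_div_iff₀ hδ]; linarith)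
  have hexp : Real.exp (-Real.log (4 / δ)) = δ / 4 := by
    rw [Real.exp_neg, Real.exp_log (by positivity), inv_div]
  obtain ⟨B₁, hB₁, hμ₁, hS₁⟩ := exists_event_deviation_le P hG hne hb hM hm 1 hL
  obtain ⟨B₂, hB₂, hμ₂, hS₂⟩ := exists_event_deviation_le P hG hne hb hM hm (-1) hL
  rw [hexp] at hμ₁ hμ₂
  refine ⟨B₁ ∪ B₂, hB₁.union hB₂, ?_, fun S hS g hg => ?_⟩
  · refine (measure_union_le _ _).trans ((add_le_add hμ₁ hμ₂).trans_eq ?_)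
    rw [← ENNReal.ofReal_add (by positivity) (by positivity)]
    congr 1
    ring
  · rw [integral_empiricalDist S (hG.1 g hg)]
    have h1 := hS₁ S (fun h => hS (Or.inl h)) g hg
    have h2 := hS₂ S (fun h => hS (Or.inr h)) g hg
    push_cast at h1 h2
    exact abs_le.2 ⟨by linarith, by linarith⟩

/-- The generalization bound for the discrepancy, in terms of the Rademacher complexities of the
loss class. -/
theorem exists_event_abs_disc_sub_le (P Q : Measure X) [IsProbabilityMeasure P]
    [IsProbabilityMeasure Q] {m n : ℕ} (hm : 0 < m) (hn : 0 < n) {δ : ℝ} (hδ : 0 < δ)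
    (hne : H.Nonempty) (hG : IsMeasurableClass (lossClass H ℓ))
    (hb : ∀ h ∈ H, ∀ h' ∈ H, ∀ x, 0 ≤ ℓ (h x) (h' x) ∧ ℓ (h x) (h' x) ≤ M) :
    ∃ A : Set ((Fin m → X) × (Fin n → X)), MeasurableSet A ∧
      ENNReal.ofReal (1 - δ) ≤ sampleLaw P Q m n A ∧
      ∀ S ∈ A,
        ((|disc H ℓ P Q - disc H ℓ (empiricalDist S.1) (empiricalDist S.2)| : ℝ) : EReal) ≤
          empRademacher (lossClass H ℓ) S.1 + empRademacher (lossClass H ℓ) S.2 +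
            (deviation M δ m n : EReal) := by
  -- For `1 ≤ δ` the empty event has the required probability.
  rcases le_or_gt 1 δ with hδ1 | hδ1
  · exact ⟨∅, MeasurableSet.empty, by simp [ENNReal.ofReal_eq_zero.2 (sub_nonpos.2 hδ1)],
      fun S hS => hS.elim⟩
  have hne' := nonempty_lossClass (ℓ := ℓ) hne
  have hb' := lossClass_bounds hb
  have hM : 0 ≤ M := by
    obtain ⟨x⟩ := nonempty_of_isProbabilityMeasure P
    obtain ⟨h, hh⟩ := hne
    exact (hb h hh h hh x).1.trans (hb h hh h hh x).2
  obtain ⟨B₁, hB₁, hμ₁, hS₁⟩ := exists_event_abs_deviation_le P hG hne' hb' hM hm hδ hδ1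
  obtain ⟨B₂, hB₂, hμ₂, hS₂⟩ := exists_event_abs_deviation_le Q hG hne' hb' hM hn hδ hδ1
  have : IsProbabilityMeasure (sampleLaw P Q m n) := by
    unfold sampleLaw
    infer_instance
  have hE₁ : MeasurableSet (Prod.fst ⁻¹' B₁ : Set ((Fin m → X) × (Fin n → X))) :=
    measurable_fst hB₁
  have hE₂ : MeasurableSet (Prod.snd ⁻¹' B₂ : Set ((Fin m → X) × (Fin n → X))) :=
    measurable_snd hB₂
  refine ⟨(Prod.fst ⁻¹' B₁ ∪ Prod.snd ⁻¹' B₂)ᶜ, (hE₁.union hE₂).compl, ?_, fun S hS => ?_⟩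
  · rw [prob_compl_eq_one_sub (hE₁.union hE₂), ENNReal.ofReal_sub _ hδ.le, ENNReal.ofReal_one]
    refine tsub_le_tsub_left ((measure_union_le _ _).trans ?_) _
    have h₁ : sampleLaw P Q m n (Prod.fst ⁻¹' B₁) = (Measure.pi fun _ => P) B₁ :=
      measurePreserving_fst.measure_preimage hB₁.nullMeasurableSet
    have h₂ : sampleLaw P Q m n (Prod.snd ⁻¹' B₂) = (Measure.pi fun _ => Q) B₂ :=
      measurePreserving_snd.measure_preimage hB₂.nullMeasurableSet
    rw [h₁, h₂]
    refine (add_le_add hμ₁ hμ₂).trans_eq ?_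
    rw [← ENNReal.ofReal_add (by positivity) (by positivity), add_halves]
  · have := isProbabilityMeasure_empiricalDist hm S.1
    have := isProbabilityMeasure_empiricalDist hn S.2
    have h := abs_disc_sub_disc_le hne hb P Q (empiricalDist S.1) (empiricalDist S.2)
      (hS₁ S.1 fun h => hS (Or.inl h)) (hS₂ S.2 fun h => hS (Or.inr h))
    rw [← coe_toReal_empRademacher hne' hb' S.1, ← coe_toReal_empRademacher hne' hb' S.2,
      ← EReal.coe_add, ← EReal.coe_add, EReal.coe_le_coe_iff]
    refine h.trans_eq ?_
    rw [deviation]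
    ring

end Discrepancy

theorem theorem3 {X Y : Type*} [MeasurableSpace X]
    (P Q : Measure X) [IsProbabilityMeasure P] [IsProbabilityMeasure Q]
    {m n : ℕ} (hm : 0 < m) (hn : 0 < n) (M δ : ℝ) (hδ : 0 < δ) :
    (∀ (H : Set (X → Y)) (ℓ : Y → Y → ℝ), H.Nonempty → IsMeasurableClass (lossClass H ℓ) →
      (∀ h ∈ H, ∀ h' ∈ H, ∀ x, 0 ≤ ℓ (h x) (h' x) ∧ ℓ (h x) (h' x) ≤ M) →
      ∃ A : Set ((Fin m → X) × (Fin n → X)), MeasurableSet A ∧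
        ENNReal.ofReal (1 - δ) ≤ sampleLaw P Q m n A ∧
        ∀ S ∈ A,
          ((|disc H ℓ P Q - disc H ℓ (empiricalDist S.1) (empiricalDist S.2)| : ℝ) : EReal) ≤
            empRademacher (lossClass H ℓ) S.1 + empRademacher (lossClass H ℓ) S.2 +
              (deviation M δ m n : EReal)) ∧
    (∀ (H : Set (X → ℝ)) (ℓ : ℝ → ℝ → ℝ) (q : ℝ≥0), H.Nonempty →
      IsMeasurableClass (lossClass H ℓ) →
      (∀ h ∈ H, ∀ h' ∈ H, ∀ x, 0 ≤ ℓ (h x) (h' x) ∧ ℓ (h x) (h' x) ≤ M) →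
      (∃ f : ℝ → ℝ, LipschitzWith q f ∧
        ∀ h ∈ H, ∀ h' ∈ H, ∀ x, ℓ (h x) (h' x) = f (h x - h' x)) →
      ∃ A : Set ((Fin m → X) × (Fin n → X)), MeasurableSet A ∧
        ENNReal.ofReal (1 - δ) ≤ sampleLaw P Q m n A ∧
        ∀ S ∈ A,
          ((|disc H ℓ P Q - disc H ℓ (empiricalDist S.1) (empiricalDist S.2)| : ℝ) : EReal) ≤
            empRademacher (lossClass H ℓ) S.1 + empRademacher (lossClass H ℓ) S.2 +
              (deviation M δ m n : EReal) ∧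
          ((|disc H ℓ P Q - disc H ℓ (empiricalDist S.1) (empiricalDist S.2)| : ℝ) : EReal) ≤
            ((4 * (q : ℝ) : ℝ) : EReal) * (empRademacher H S.1 + empRademacher H S.2) +
              (deviation M δ m n : EReal)) := by
  refine ⟨fun H ℓ hne hG hb => exists_event_abs_disc_sub_le P Q hm hn hδ hne hG hb,
    fun H ℓ q hne hG hb hf => ?_⟩
  obtain ⟨f, hf, hℓ⟩ := hf
  obtain ⟨A, hA, hμ, hS⟩ := exists_event_abs_disc_sub_le P Q hm hn hδ hne hG hb
  refine ⟨A, hA, hμ, fun S hSA => ⟨hS S hSA, (hS S hSA).trans ?_⟩⟩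
  rw [EReal.left_distrib_of_nonneg (empRademacher_nonneg hne S.1) (empRademacher_nonneg hne S.2)]
  gcongr
  · exact empRademacher_lossClass_le hne (lossClass_bounds hb) hf hℓ hm S.1
  · exact empRademacher_lossClass_le hne (lossClass_bounds hb) hf hℓ hn S.2
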